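/- **Theorem 1 (QDAC with ancilla).** There is a real polynomial $p$ such that for all integers $n,m\ge 0$, with $N=2^n$ and $\epsilon=2^{-m}$, there is a quantum algorithm performing $m$-bit quantum digital-to-analog conversion (QDAC) of $N$ data, as follows. The algorithm acts on an $n$-qubit address register, an $m$-qubit data register, finitely many work qubits and one ancilla qubit. It consists of a quantum circuit, one measurement of the ancilla in the computational basis, and a further circuit that is run if the outcome is $0$ (success). The circuits are built from arbitrary single- and two-qubit gates and calls of the adjoint $U_D^\dagger$ of a unitary $U_D$ on the address and data registers. Altogether they contain at most $p(\log(1/\epsilon))$ single- and two-qubit gates, that is $O(\mathrm{poly}(\log(1/\epsilon)))$, and exactly one call of $U_D^\dagger$. They depend only on $n$ and $m$, not on the data or on $U_D$. Let $d_j=\sum_{k=1}^m d_j^{(k)}2^{-k}\in[0,1)$ with $d_j^{(k)}\in\{0,1\}$ be any data, where $j$ ranges over the $N$ computational basis labels of the address register, let $\mathbf d_j=d_j^{(1)}\cdots d_j^{(m)}$, and let $U_D$ be any unitary with $U_D|j\rangle|0\rangle^{\otimes m}=|j\rangle|\mathbf d_j\rangle$ for all $j$. On the digital-encoded state $$\frac1{\sqrt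 N}\sum_{j}|j\rangle|\mathbf d_j\rangle ,$$ with the work qubits and the ancilla in $|0\rangle$, the algorithm succeeds with probability exactly $\frac1N\sum_j d_j^2$. If not all $d_j$ are zero, then its final state in case of success is exactly $$C\sum_{j} d_j\,|j\rangle|0\rangle^{\otimes m},\qquad C=\Big(\sum_j d_j^2\Big)^{-1/2},$$ with the work qubits and the ancilla again in $|0\rangle$. -/

import Mathlib

namespace QDAC

/-! ### Qubit registers, gates and their action -/

/-- A (possibly unnormalised) state vector of a register of qubits labelled by `ι`:
its amplitudes in the computational basis `ι → Bool`. -/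
abbrev State (ι : Type) : Type := (ι → Bool) → ℂ

/-- The computational basis state `|x⟩`. -/
def ket {ι : Type} [DecidableEq (ι → Bool)] (x : ι → Bool) : State ι := Pi.single x 1

/-- The operator `M`, given by its matrix in the computational basis of the qubits `κ`, applied to
the qubits `e k` (`k : κ`) of a larger register `ι`, tensored with the identity on the others.
(`Function.extend e y x` is the bit string `x` with its bits at the positions `e k` replaced
by `y k`.) -/
noncomputable def applyOn {κ ι : Type} [Fintype (κ → Bool)] (e : κ ↪ ι)
    (M : Matrix (κ → Bool) (κ → Bool) ℂ) (ψ : State ι) : State ι :=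
  fun x => ∑ y : κ → Bool, M (fun k => x (e k)) y * ψ (Function.extend e y x)

/-- The Born weight `‖ψ‖²` of a state vector. -/
noncomputable def weight {ι : Type} [Fintype (ι → Bool)] (ψ : State ι) : ℝ :=
  ∑ x, ‖ψ x‖ ^ 2

/-! ### Circuits with access to the adjoint of a digital-encoding unitary -/

/-- The qubits of the machine: `n` address qubits, `m` data qubits, `w` work qubits and one
ancilla qubit. -/
abbrev Wire (n m w : ℕ) : Type := Fin n ⊕ Fin m ⊕ Fin w ⊕ Unit

/-- The basis label of `|j⟩|x⟩|y⟩|b⟩` (address, data, work, ancilla). -/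
def label {n m w : ℕ} (j : Fin n → Bool) (x : Fin m → Bool) (y : Fin w → Bool) (b : Bool) :
    Wire n m w → Bool :=
  Sum.elim j (Sum.elim x (Sum.elim y fun _ => b))

/-- The ancilla qubit. -/
def ancilla {n m w : ℕ} : Wire n m w := Sum.inr (Sum.inr (Sum.inr ()))

/-- The address and data registers as qubits of the machine. -/
def addressData (n m w : ℕ) : Fin n ⊕ Fin m ↪ Wire n m w where
  toFun := Sum.elim Sum.inl fun i => Sum.inr (Sum.inl i)
  inj' := by
    rintro (a | a) (b | b) h <;> simp_all

/-- One operation of a circuit: an arbitrary single-qubit gate, an arbitrary two-qubit gate (on two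
different qubits), or a call of `U_D†` on the address and data registers. -/
inductive Op (n m w : ℕ) : Type
  | gate₁ (e : Fin 1 ↪ Wire n m w) (V : Matrix.unitaryGroup (Fin 1 → Bool) ℂ)
  | gate₂ (e : Fin 2 ↪ Wire n m w) (V : Matrix.unitaryGroup (Fin 2 → Bool) ℂ)
  | callAdjoint

/-- Whether an operation is a single- or two-qubit gate. -/
def Op.isGate {n m w : ℕ} : Op n m w → Bool
  | .gate₁ _ _ => true
  | .gate₂ _ _ => true
  | .callAdjoint => false

/-- Whether an operation is a call of `U_D†`. -/
def Op.isCall {n m w : ℕ} : Op n m w → Bool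
  | .callAdjoint => true
  | _ => false

/-- The effect of an operation on a state vector, when `U` is the unitary `U_D`. -/
noncomputable def Op.run {n m w : ℕ} (U : Matrix.unitaryGroup (Fin n ⊕ Fin m → Bool) ℂ) :
    Op n m w → State (Wire n m w) → State (Wire n m w)
  | .gate₁ e V, ψ => applyOn e V.1 ψ
  | .gate₂ e V, ψ => applyOn e V.1 ψ
  | .callAdjoint, ψ => applyOn (addressData n m w) U.1.conjTranspose ψ

/-- Run a list of operations, the head of the list first. -/
noncomputable def runOps {n m w : ℕ} (U : Matrix.unitaryGroup (Fin n ⊕ Fin m → Bool) ℂ)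
    (c : List (Op n m w)) (ψ : State (Wire n m w)) : State (Wire n m w) :=
  c.foldl (fun φ o => o.run U φ) ψ

/-- The (unnormalised) component of a state vector in which the ancilla is `|0⟩`. -/
def projectAncilla {n m w : ℕ} (ψ : State (Wire n m w)) : State (Wire n m w) :=
  fun x => if x ancilla = false then ψ x else 0

/-- A quantum algorithm with one ancilla measurement: run the circuit `before`, measure the ancilla
in the computational basis, and, if the outcome is `0` (success), run the circuit `after`. -/
structure Algorithm (n m w : ℕ) : Type where
  before : List (Op n m w)
  after : List (Op n m w)

namespace Algorithm

variable {n m w : ℕ}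

/-- The total number of single- and two-qubit gates. -/
def gateCount (A : Algorithm n m w) : ℕ := (A.before ++ A.after).countP Op.isGate

/-- The total number of calls of `U_D†`. -/
def callCount (A : Algorithm n m w) : ℕ := (A.before ++ A.after).countP Op.isCall

/-- The probability that the measurement of the ancilla has outcome `0`, on the (normalised)
input `ψ`. -/
noncomputable def successProb (A : Algorithm n m w)
    (U : Matrix.unitaryGroup (Fin n ⊕ Fin m → Bool) ℂ) (ψ : State (Wire n m w)) : ℝ :=
  weight (projectAncilla (runOps U A.before ψ))

/-- The final state on the input `ψ`, given that the measurement of the ancilla had outcome `0`: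
the projected state is renormalised, and then `after` is run. -/
noncomputable def output (A : Algorithm n m w)
    (U : Matrix.unitaryGroup (Fin n ⊕ Fin m → Bool) ℂ) (ψ : State (Wire n m w)) :
    State (Wire n m w) :=
  runOps U A.after
    (((Real.sqrt (A.successProb U ψ) : ℂ))⁻¹ • projectAncilla (runOps U A.before ψ))

end Algorithm

/-! ### Digital and analog encodings -/

/-- The number `∑_{k=1}^m b^{(k)} 2^{-k}` in `[0,1)` with binary digits `b^{(1)} ⋯ b^{(m)}`
(here `b^{(k+1)}` is `b k`). -/
noncomputable def value {m : ℕ} (b : Fin m → Bool) : ℝ :=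
  ∑ k : Fin m, if b k then (1 / 2 : ℝ) ^ ((k : ℕ) + 1) else 0

/-- `U` is a digital-encoding unitary of the data `d`: `U |j⟩|0⟩ = |j⟩|d_j⟩` for all `j`.
Nothing is said about its action on `|j⟩|x⟩` with `x ≠ 0`. -/
def IsDigitalEncoding {n m : ℕ} (d : (Fin n → Bool) → Fin m → Bool)
    (U : Matrix.unitaryGroup (Fin n ⊕ Fin m → Bool) ℂ) : Prop :=
  ∀ j : Fin n → Bool,
    U.1.mulVec (ket (Sum.elim j fun _ => false)) = ket (Sum.elim j (d j))

/-- The digital-encoded state `N^{-1/2} ∑_j |j⟩|d_j⟩`, `N = 2^n`, with work qubits and ancilla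
in `|0⟩`. -/
noncomputable def digitalState {n m : ℕ} (w : ℕ) (d : (Fin n → Bool) → Fin m → Bool) :
    State (Wire n m w) :=
  (Real.sqrt (2 ^ n : ℝ) : ℂ)⁻¹ •
    ∑ j : Fin n → Bool, ket (label j (d j) (fun _ => false) false)

/-- The analog-encoded state `C ∑_j d_j |j⟩|0⟩^{⊗m}`, `C = (∑_j d_j²)^{-1/2}`, with work qubits and
ancilla in `|0⟩`. -/
noncomputable def analogState {n m : ℕ} (w : ℕ) (d : (Fin n → Bool) → Fin m → Bool) :
    State (Wire n m w) :=
  (Real.sqrt (∑ j, value (d j) ^ 2) : ℂ)⁻¹ •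
    ∑ j : Fin n → Bool,
      (value (d j) : ℂ) • ket (label j (fun _ => false) (fun _ => false) false)

end QDAC

namespace QDAC

open Matrix

/-! ### Gates acting on basis states. -/

section Gates

variable {κ ι : Type}

/-! Conditionally on the address and data strings, the circuit moves one excitation among the
ancilla (the site `top`) and the `m + 1` work qubits. All gates between the two `X` gates preserve
this subspace, so only an amplitude vector on the sites has to be followed.

On an empty work qubit and `top`, `mixGate` splits the amplitude equally; a second `mixGate` sends
half the sum of the two factors acquired meanwhile back to `top`. This averages two factors. If the
tail of a digit string has value `v'`, averaging `1 - 2v'` (obtained recursively) with `(-1)^b` (a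
controlled sign) gives `1 - b - v' = 1 - 2v`, where `v = (b + v')/2`. One outer averaging, of `1`
with `-(1 - 2v)`, gives `v` itself (`digitMap_top`, `finalMap_top`).

Success means that the excitation is at `top`; the last `X` then leaves the ancilla and all work
qubits in `|0⟩`. The projected state is thus a multiple of `∑ d_j |j⟩|𝐝_j⟩`, and `U_D†` erases the
data register. Each digit costs three gates, and five more surround them. -/

lemma applyOn_smul [Fintype (κ → Bool)] (e : κ ↪ ι) (M : Matrix (κ → Bool) (κ → Bool) ℂ)
    (c : ℂ) (ψ : State ι) : applyOn e M (c • ψ) = c • applyOn e M ψ := by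
  funext x
  simp only [applyOn, Pi.smul_apply, smul_eq_mul, Finset.mul_sum]
  exact Finset.sum_congr rfl fun y _ => by ring

lemma applyOn_sum [Fintype (κ → Bool)] {α : Type} (e : κ ↪ ι)
    (M : Matrix (κ → Bool) (κ → Bool) ℂ) (s : Finset α) (f : α → State ι) :
    applyOn e M (∑ a ∈ s, f a) = ∑ a ∈ s, applyOn e M (f a) := by
  funext x
  simp only [applyOn, Finset.sum_apply, Finset.mul_sum]
  rw [Finset.sum_comm]

/-- Overwriting bits is undone by writing the old bits back. This links the row form of a matrix,
used by `applyOn`, to its column form on basis states. -/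
lemma extend_eq_iff (e : κ ↪ ι) (x z : ι → Bool) (y : κ → Bool) :
    Function.extend e y z = x ↔
      y = (fun k => x (e k)) ∧ Function.extend e (fun k => z (e k)) x = z := by
  constructor
  · rintro rfl
    refine ⟨funext fun k => (e.injective.extend_apply _ _ k).symm, funext fun i => ?_⟩
    by_cases h : ∃ k, e k = i
    · obtain ⟨k, rfl⟩ := h
      rw [e.injective.extend_apply]
    · rw [Function.extend_apply' _ _ _ h, Function.extend_apply' _ _ _ h]
  · rintro ⟨rfl, h⟩
    funext i
    by_cases hi : ∃ k, e k = i
    · obtain ⟨k, rfl⟩ := hi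
      rw [e.injective.extend_apply]
    · rw [Function.extend_apply' _ _ _ hi, ← h, Function.extend_apply' _ _ _ hi]

lemma applyOn_ket [Fintype (κ → Bool)] [DecidableEq (ι → Bool)] (e : κ ↪ ι)
    (M : Matrix (κ → Bool) (κ → Bool) ℂ) (x : ι → Bool) :
    applyOn e M (ket x) =
      ∑ y : κ → Bool, M y (fun k => x (e k)) • ket (Function.extend e y x) := by
  classical
  funext z
  simp only [applyOn, ket, Finset.sum_apply, Pi.smul_apply, smul_eq_mul, Pi.single_apply,
    mul_ite, mul_one, mul_zero]
  -- Each side has at most one nonzero term: on the left `y` must be the bits of `x`, on the right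
  -- those of `z`.
  rw [Finset.sum_eq_single (fun k => x (e k)), Finset.sum_eq_single (fun k => z (e k))]
  · have h := extend_eq_iff e x z (fun k => x (e k))
    simp only [true_and] at h
    by_cases hz : Function.extend e (fun k => z (e k)) x = z
    · rw [if_pos (h.2 hz), if_pos hz.symm]
    · rw [if_neg (fun h' => hz (h.1 h')), if_neg (fun h' => hz h'.symm)]
  · intro y _ hy
    refine if_neg fun h => hy ?_
    rw [h]
    exact funext fun k => (e.injective.extend_apply _ _ k).symm
  · simp
  · intro y _ hy
    exact if_neg fun h => hy ((extend_eq_iff e x z y).1 h).1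
  · simp

lemma applyOn_diagonal_ket [Fintype (κ → Bool)] [DecidableEq (κ → Bool)] [DecidableEq (ι → Bool)]
    (e : κ ↪ ι) (f : (κ → Bool) → ℂ) (x : ι → Bool) :
    applyOn e (diagonal f) (ket x) = f (fun k => x (e k)) • ket x := by
  rw [applyOn_ket, Finset.sum_eq_single (fun k => x (e k)), diagonal_apply_eq,
    ((extend_eq_iff e x x (fun k => x (e k))).2 ⟨rfl, ?_⟩)]
  · funext i
    by_cases hi : ∃ k, e k = i
    · obtain ⟨k, rfl⟩ := hi
      rw [e.injective.extend_apply]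
    · rw [Function.extend_apply' _ _ _ hi]
  · intro y _ hy
    rw [diagonal_apply_ne _ hy, zero_smul]
  · simp

/-- The selection of the single qubit `a`. -/
def one (a : ι) : Fin 1 ↪ ι := ⟨fun _ => a, fun _ _ _ => Subsingleton.elim _ _⟩

/-- The selection of two different qubits `a` and `b`, in this order. -/
def pair (a b : ι) (h : a ≠ b) : Fin 2 ↪ ι where
  toFun := ![a, b]
  inj' := by
    intro i k hik
    fin_cases i <;> fin_cases k <;> simp_all

@[simp] lemma one_apply_zero (a : ι) : one a 0 = a := rfl

@[simp] lemma pair_apply_zero (a b : ι) (h : a ≠ b) : pair a b h 0 = a := rfl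

@[simp] lemma pair_apply_one (a b : ι) (h : a ≠ b) : pair a b h 1 = b := rfl

lemma sum_bool_one {β : Type} [AddCommMonoid β] (f : (Fin 1 → Bool) → β) :
    ∑ y, f y = f ![true] + f ![false] := by
  rw [← (Equiv.funUnique (Fin 1) Bool).symm.sum_comp, Fintype.sum_bool]
  congr 2 <;> exact funext fun i => by fin_cases i; rfl

lemma sum_bool_two {β : Type} [AddCommMonoid β] (f : (Fin 2 → Bool) → β) :
    ∑ y, f y = f ![true, true] + f ![true, false] + (f ![false, true] + f ![false, false]) := by
  rw [← (finTwoArrowEquiv Bool).symm.sum_comp, Fintype.sum_prod_type]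
  simp

lemma extend_one [DecidableEq ι] (a : ι) (p : Bool) (x : ι → Bool) :
    Function.extend (one a) ![p] x = Function.update x a p := by
  funext i
  by_cases h : i = a
  · subst h
    rw [Function.update_self]
    exact (one i).injective.extend_apply _ _ 0
  · rw [Function.update_of_ne h, Function.extend_apply']
    rintro ⟨k, hk⟩
    exact h hk.symm

lemma extend_pair [DecidableEq ι] (a b : ι) (h : a ≠ b) (p q : Bool) (x : ι → Bool) :
    Function.extend (pair a b h) ![p, q] x = Function.update (Function.update x a p) b q := by
  funext i
  by_cases hb : i = b
  · subst hb
    rw [Function.update_self]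
    exact (pair a i h).injective.extend_apply _ _ 1
  · rw [Function.update_of_ne hb]
    by_cases ha : i = a
    · subst ha
      rw [Function.update_self]
      exact (pair i b h).injective.extend_apply _ _ 0
    · rw [Function.update_of_ne ha, Function.extend_apply']
      rintro ⟨k, hk⟩
      fin_cases k
      · exact ha hk.symm
      · exact hb hk.symm

/-- The Pauli gate `X`. -/
def notGate : unitaryGroup (Fin 1 → Bool) ℂ :=
  ⟨of fun x y => if x 0 = y 0 then 0 else 1, by
    rw [mem_unitaryGroup_iff']
    ext x y
    obtain ⟨p, rfl⟩ : ∃ p, x = ![p] := ⟨x 0, by ext i; fin_cases i; rfl⟩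
    obtain ⟨q, rfl⟩ : ∃ q, y = ![q] := ⟨y 0, by ext i; fin_cases i; rfl⟩
    rw [mul_apply, sum_bool_one]
    cases p <;> cases q <;> simp [star_apply, one_apply]⟩

/-- The Pauli gate `Z`. -/
def signGate : unitaryGroup (Fin 1 → Bool) ℂ :=
  ⟨diagonal fun x => if x 0 then -1 else 1, by
    rw [mem_unitaryGroup_iff', star_eq_conjTranspose, diagonal_conjTranspose, diagonal_mul_diagonal,
      ← diagonal_one]
    congr 1
    funext x
    cases h : x 0 <;> simp [h]⟩

/-- The controlled-`Z` gate. -/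
def controlledSignGate : unitaryGroup (Fin 2 → Bool) ℂ :=
  ⟨diagonal fun x => if x 0 && x 1 then -1 else 1, by
    rw [mem_unitaryGroup_iff', star_eq_conjTranspose, diagonal_conjTranspose, diagonal_mul_diagonal,
      ← diagonal_one]
    congr 1
    funext x
    cases h : x 0 <;> cases h' : x 1 <;> simp [h, h']⟩

/-- The amplitude `2^{-1/2}`. -/
noncomputable def invSqrtTwo : ℂ := ((Real.sqrt 2)⁻¹ : ℝ)

lemma invSqrtTwo_mul_self : invSqrtTwo * invSqrtTwo = 1 / 2 := by
  rw [invSqrtTwo, ← Complex.ofReal_mul, ← mul_inv, Real.mul_self_sqrt (by norm_num)]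
  norm_num

/-- The gate that is a Hadamard gate on the span of `|10⟩`, `|01⟩` and fixes `|00⟩`, `|11⟩`. -/
noncomputable def mixGate : unitaryGroup (Fin 2 → Bool) ℂ :=
  ⟨of fun x y =>
    if x 0 = x 1 ∨ y 0 = y 1 then (if x 0 = y 0 ∧ x 1 = y 1 then 1 else 0)
    else if x 1 ∧ y 1 then -invSqrtTwo else invSqrtTwo, by
    rw [mem_unitaryGroup_iff']
    have hs : star invSqrtTwo = invSqrtTwo := Complex.conj_ofReal _
    have hs' : (starRingEnd ℂ) invSqrtTwo = invSqrtTwo := hs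
    ext x y
    obtain ⟨p, p', rfl⟩ : ∃ p p', x = ![p, p'] :=
      ⟨x 0, x 1, by ext i; fin_cases i <;> rfl⟩
    obtain ⟨q, q', rfl⟩ : ∃ q q', y = ![q, q'] :=
      ⟨y 0, y 1, by ext i; fin_cases i <;> rfl⟩
    rw [mul_apply, sum_bool_two]
    cases p <;> cases p' <;> cases q <;> cases q' <;>
      simp [star_apply, one_apply, hs', invSqrtTwo_mul_self] <;> norm_num⟩

variable [DecidableEq (ι → Bool)]

lemma notGate_ket [DecidableEq ι] (a : ι) (x : ι → Bool) :
    applyOn (one a) notGate.1 (ket x) = ket (Function.update x a (!x a)) := by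
  rw [applyOn_ket, sum_bool_one, extend_one, extend_one]
  cases h : x a <;> simp [notGate, h]

lemma signGate_ket (a : ι) (x : ι → Bool) :
    applyOn (one a) signGate.1 (ket x) = (if x a then -1 else 1 : ℂ) • ket x :=
  applyOn_diagonal_ket _ _ _

lemma controlledSignGate_ket (a b : ι) (h : a ≠ b) (x : ι → Bool) :
    applyOn (pair a b h) controlledSignGate.1 (ket x) =
      (if x a && x b then -1 else 1 : ℂ) • ket x :=
  applyOn_diagonal_ket _ _ _

lemma mixGate_ket [DecidableEq ι] (a b : ι) (h : a ≠ b) (x : ι → Bool) :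
    applyOn (pair a b h) mixGate.1 (ket x) =
      if x a = x b then ket x else
        invSqrtTwo • (ket (Function.update (Function.update x a true) b false) +
          (if x b then -1 else 1 : ℂ) • ket (Function.update (Function.update x a false) b true)) := by
  rw [applyOn_ket, sum_bool_two]
  simp only [extend_pair]
  have hx : Function.update (Function.update x a (x a)) b (x b) = x := by simp
  cases ha : x a <;> cases hb : x b <;> rw [ha, hb] at hx <;> simp [mixGate, ha, hb, hx]

end Gates

/-! ### The single-excitation subspace. -/

section Excitation

variable {n m w : ℕ}

/-- The work qubits and the ancilla, among which a single excitation moves. -/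
abbrev Site (w : ℕ) : Type := Fin w ⊕ Unit

/-- A site as a qubit of the machine. -/
def siteWire (s : Site w) : Wire n m w := Sum.inr (Sum.inr s)

lemma siteWire_injective : Function.Injective (siteWire : Site w → Wire n m w) :=
  Sum.inr_injective.comp Sum.inr_injective

/-- The basis label with address `j`, data `b`, and a single excitation at the site `s`. -/
def excited (j : Fin n → Bool) (b : Fin m → Bool) (s : Site w) : Wire n m w → Bool :=
  Sum.elim j (Sum.elim b fun r => decide (r = s))

@[simp] lemma excited_siteWire (j : Fin n → Bool) (b : Fin m → Bool) (s r : Site w) :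
    excited j b s (siteWire r) = decide (r = s) := rfl

lemma update_update_excited (j : Fin n → Bool) (b : Fin m → Bool) {s t u : Site w} (hst : s ≠ t)
    (hu : u = s ∨ u = t) :
    Function.update (Function.update (excited j b u) (siteWire s) true) (siteWire t) false
      = excited j b s := by
  funext i
  rcases i with i | i | r
  · simp [siteWire, Function.update, excited]
  · simp [siteWire, Function.update, excited]
  · change Function.update (Function.update (excited j b u) (siteWire s) true) (siteWire t) false
      (siteWire r)
      = excited j b s (siteWire r)
    simp only [Function.update_apply, siteWire_injective.eq_iff, excited_siteWire]
    grind

lemma update_update_excited' (j : Fin n → Bool) (b : Fin m → Bool) {s t u : Site w} (hst : s ≠ t)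
    (hu : u = s ∨ u = t) :
    Function.update (Function.update (excited j b u) (siteWire s) false) (siteWire t) true
      = excited j b t := by
  rw [Function.update_comm (fun h => hst (siteWire_injective h))]
  exact update_update_excited j b hst.symm hu.symm

/-- The state with address `j`, data `b`, and a single excitation distributed over the sites with
amplitudes `φ`. -/
def excitation (j : Fin n → Bool) (b : Fin m → Bool) (φ : Site w → ℂ) : State (Wire n m w) :=
  ∑ s, φ s • ket (excited j b s)

lemma applyOn_excitation {κ : Type} [Fintype (κ → Bool)] (e : κ ↪ Wire n m w)
    (M : Matrix (κ → Bool) (κ → Bool) ℂ) (j : Fin n → Bool) (b : Fin m → Bool) (φ : Site w → ℂ) :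
    applyOn e M (excitation j b φ) = ∑ s, φ s • applyOn e M (ket (excited j b s)) := by
  rw [excitation, applyOn_sum]
  exact Finset.sum_congr rfl fun s _ => applyOn_smul _ _ _ _

/-- The action of `mixGate` on excitation amplitudes. -/
noncomputable def mix (s t : Site w) (φ : Site w → ℂ) : Site w → ℂ := fun r =>
  if r = s then invSqrtTwo * (φ s + φ t) else if r = t then invSqrtTwo * (φ s - φ t) else φ r

/-- Multiplication of the amplitude at the site `s` by `c`. -/
def scale (s : Site w) (c : ℂ) (φ : Site w → ℂ) : Site w → ℂ := fun r =>
  if r = s then c * φ s else φ r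

lemma sum_sites_split {β : Type} [AddCommMonoid β] {s t : Site w} (hst : s ≠ t)
    (f : Site w → β) : ∑ r, f r = f s + (f t + ∑ r ∈ (Finset.univ.erase s).erase t, f r) := by
  rw [← Finset.add_sum_erase _ f (Finset.mem_univ s),
    ← Finset.add_sum_erase _ f (Finset.mem_erase.2 ⟨hst.symm, Finset.mem_univ t⟩)]

/-- The gate rotates the two states with the excitation at `s` or `t` and fixes those with both
sites empty; both sites are never occupied together. -/
lemma mixGate_excitation (j : Fin n → Bool) (b : Fin m → Bool) (φ : Site w → ℂ) {s t : Site w}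
    (hst : s ≠ t) (h : (siteWire s : Wire n m w) ≠ siteWire t) :
    applyOn (pair (siteWire s) (siteWire t) h) mixGate.1 (excitation j b φ) =
      excitation j b (mix s t φ) := by
  rw [applyOn_excitation, excitation, sum_sites_split hst, sum_sites_split hst,
    Finset.sum_congr (g := fun r => mix s t φ r • ket (excited j b r)) rfl]
  · simp only [mixGate_ket, excited_siteWire, mix, hst, hst.symm, decide_true, decide_false,
      if_true, if_false, update_update_excited j b hst (Or.inl rfl),
      update_update_excited j b hst (Or.inr rfl), update_update_excited' j b hst (Or.inl rfl),
      update_update_excited' j b hst (Or.inr rfl), Bool.false_eq_true, reduceCtorEq]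
    module
  · intro r hr
    simp only [Finset.mem_erase, Finset.mem_univ, and_true] at hr
    rw [mixGate_ket]
    simp [mix, hr.1, hr.2, hr.1.symm, hr.2.symm]

lemma signGate_excitation (j : Fin n → Bool) (b : Fin m → Bool) (φ : Site w → ℂ) (s : Site w) :
    applyOn (one (siteWire s)) signGate.1 (excitation j b φ) =
      excitation j b (scale s (-1) φ) := by
  rw [applyOn_excitation, excitation]
  refine Finset.sum_congr rfl fun r _ => ?_
  rw [signGate_ket, smul_smul, scale]
  by_cases hr : r = s
  · subst hr
    simp
  · simp [hr, Ne.symm hr]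

/-- For a fixed data string the control is a classical bit, so the phase lands on the amplitude at
`s` alone. -/
lemma controlledSignGate_excitation (j : Fin n → Bool) (b : Fin m → Bool) (φ : Site w → ℂ)
    (k : Fin m) (s : Site w) (h : (Sum.inr (Sum.inl k) : Wire n m w) ≠ siteWire s) :
    applyOn (pair (Sum.inr (Sum.inl k)) (siteWire s) h) controlledSignGate.1 (excitation j b φ) =
      excitation j b (scale s (if b k then -1 else 1) φ) := by
  rw [applyOn_excitation, excitation]
  refine Finset.sum_congr rfl fun r _ => ?_
  rw [controlledSignGate_ket, smul_smul, scale]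
  have hk : excited j b r (Sum.inr (Sum.inl k)) = b k := rfl
  by_cases hr : r = s
  · subst hr
    cases hb : b k <;> simp [hk, hb]
  · simp [hr, Ne.symm hr]

end Excitation

/-! ### Circuits, and the recursive averaging over digits. -/

section Circuit

variable {n m w : ℕ}

lemma Op.run_smul (U : unitaryGroup (Fin n ⊕ Fin m → Bool) ℂ) (o : Op n m w) (c : ℂ)
    (ψ : State (Wire n m w)) : o.run U (c • ψ) = c • o.run U ψ := by
  cases o <;> exact applyOn_smul _ _ _ _

lemma Op.run_sum {α : Type} (U : unitaryGroup (Fin n ⊕ Fin m → Bool) ℂ) (o : Op n m w)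
    (s : Finset α) (f : α → State (Wire n m w)) :
    o.run U (∑ a ∈ s, f a) = ∑ a ∈ s, o.run U (f a) := by
  cases o <;> exact applyOn_sum _ _ _ _

lemma runOps_cons (U : unitaryGroup (Fin n ⊕ Fin m → Bool) ℂ) (o : Op n m w) (c : List (Op n m w))
    (ψ : State (Wire n m w)) : runOps U (o :: c) ψ = runOps U c (o.run U ψ) := rfl

lemma runOps_append (U : unitaryGroup (Fin n ⊕ Fin m → Bool) ℂ) (c c' : List (Op n m w))
    (ψ : State (Wire n m w)) : runOps U (c ++ c') ψ = runOps U c' (runOps U c ψ) :=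
  List.foldl_append

lemma runOps_smul (U : unitaryGroup (Fin n ⊕ Fin m → Bool) ℂ) (c : List (Op n m w)) (a : ℂ)
    (ψ : State (Wire n m w)) : runOps U c (a • ψ) = a • runOps U c ψ := by
  induction c generalizing ψ with
  | nil => rfl
  | cons o c ih => rw [runOps_cons, runOps_cons, Op.run_smul, ih]

lemma runOps_sum {α : Type} (U : unitaryGroup (Fin n ⊕ Fin m → Bool) ℂ) (c : List (Op n m w))
    (s : Finset α) (f : α → State (Wire n m w)) :
    runOps U c (∑ a ∈ s, f a) = ∑ a ∈ s, runOps U c (f a) := by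
  induction c generalizing f with
  | nil => rfl
  | cons o c ih =>
    rw [runOps_cons, Op.run_sum, ih]
    rfl

/-- The ancilla as a site. -/
abbrev top : Site w := Sum.inr ()

/-- The operation `mixGate` on the ancilla and the work qubit `i`. -/
noncomputable def mixOp (i : Fin w) : Op n m w :=
  .gate₂ (pair (siteWire top) (siteWire (Sum.inl i))
    (fun h => Sum.inr_ne_inl (siteWire_injective h))) mixGate

/-- The controlled sign on the data qubit `k` and the work qubit `i`. -/
def controlledSignOp (k : Fin m) (i : Fin w) : Op n m w :=
  .gate₂ (pair (Sum.inr (Sum.inl k)) (siteWire (Sum.inl i))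
    (fun h => Sum.inl_ne_inr (Sum.inr_injective h))) controlledSignGate

/-- The gate `X` on the ancilla. -/
def notOp : Op n m w := .gate₁ (one (siteWire top)) notGate

/-- The gate `Z` on the ancilla. -/
def signOp : Op n m w := .gate₁ (one (siteWire top)) signGate

/-- A circuit that multiplies the excitation amplitude at the ancilla by `1 - 2v`, where `v` has
the binary digits listed by `ks`. -/
noncomputable def digitCircuit : List (Fin m) → List (Op n m (m + 1))
  | [] => []
  | k :: ks => mixOp k.succ :: (digitCircuit ks ++ [controlledSignOp k k.succ, mixOp k.succ])

/-- The action of `digitCircuit` on excitation amplitudes, for the data `b`. -/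
noncomputable def digitMap (b : Fin m → Bool) :
    List (Fin m) → (Site (m + 1) → ℂ) → Site (m + 1) → ℂ
  | [], φ => φ
  | k :: ks, φ => mix top (Sum.inl k.succ) (scale (Sum.inl k.succ) (if b k then -1 else 1)
      (digitMap b ks (mix top (Sum.inl k.succ) φ)))

lemma run_mixOp (U : unitaryGroup (Fin n ⊕ Fin m → Bool) ℂ) (i : Fin w) (j : Fin n → Bool)
    (b : Fin m → Bool) (φ : Site w → ℂ) :
    (mixOp i).run U (excitation j b φ) = excitation j b (mix top (Sum.inl i) φ) :=
  mixGate_excitation j b φ Sum.inr_ne_inl _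

lemma run_controlledSignOp (U : unitaryGroup (Fin n ⊕ Fin m → Bool) ℂ) (k : Fin m) (i : Fin w)
    (j : Fin n → Bool) (b : Fin m → Bool) (φ : Site w → ℂ) :
    (controlledSignOp k i).run U (excitation j b φ) =
      excitation j b (scale (Sum.inl i) (if b k then -1 else 1) φ) :=
  controlledSignGate_excitation j b φ k _ _

lemma runOps_digitCircuit (U : unitaryGroup (Fin n ⊕ Fin m → Bool) ℂ) (ks : List (Fin m))
    (j : Fin n → Bool) (b : Fin m → Bool) (φ : Site (m + 1) → ℂ) :
    runOps U (digitCircuit ks) (excitation j b φ) = excitation j b (digitMap b ks φ) := by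
  induction ks generalizing φ with
  | nil => rfl
  | cons k ks ih =>
    rw [digitCircuit, runOps_cons, runOps_append, run_mixOp, ih, runOps_cons, runOps_cons]
    rw [run_controlledSignOp, run_mixOp]
    rfl

/-- The number in `[0,1)` with the given list of binary digits. -/
noncomputable def listValue : List Bool → ℝ
  | [] => 0
  | b :: l => ((if b then 1 else 0) + listValue l) / 2

/-- Horner's scheme, most significant digit first. -/
lemma listValue_ofFn (b : Fin m → Bool) : listValue (List.ofFn b) = value b := by
  induction m with
  | zero => simp [listValue, value]
  | succ m ih =>
    rw [List.ofFn_succ, listValue, ih, value, value, Fin.sum_univ_succ, add_div, Finset.sum_div]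
    congr 1
    · split_ifs <;> simp
    · refine Finset.sum_congr rfl fun k _ => ?_
      split_ifs
      · rw [Fin.val_succ, pow_succ _ (k.1 + 1)]
        ring
      · simp

/-- Each digit has its own work qubit, so amplitude parked on another one survives the inner
circuit. -/
lemma digitMap_of_notMem (b : Fin m → Bool) {ks : List (Fin m)} (φ : Site (m + 1) → ℂ)
    {i : Fin (m + 1)} (hi : ∀ k ∈ ks, k.succ ≠ i) :
    digitMap b ks φ (Sum.inl i) = φ (Sum.inl i) := by
  induction ks generalizing φ with
  | nil => rfl
  | cons k ks ih =>
    have hk : i ≠ k.succ := (hi k List.mem_cons_self).symm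
    simp [digitMap, mix, scale, hk, ih _ fun l hl => hi l (List.mem_cons_of_mem _ hl)]

/-- The averaging step of the recursion. What stays on the work qubits is irrelevant, as no later
level reads them. -/
lemma digitMap_top (b : Fin m → Bool) {ks : List (Fin m)} (hks : ks.Nodup)
    (φ : Site (m + 1) → ℂ) (hφ : ∀ k ∈ ks, φ (Sum.inl k.succ) = 0) :
    digitMap b ks φ top = (1 - 2 * (listValue (ks.map b) : ℂ)) * φ top := by
  induction ks generalizing φ with
  | nil => simp [digitMap, listValue]
  | cons k ks ih =>
    obtain ⟨hk, hks⟩ := List.nodup_cons.1 hks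
    have h0 : φ (Sum.inl k.succ) = 0 := hφ k List.mem_cons_self
    -- The outer mixing fills only the site of `k`; since digits do not repeat, the sites of the
    -- remaining ones are still empty.
    have h1 := ih hks (mix top (Sum.inl k.succ) φ) fun l hl => by
      have : l ≠ k := fun h => hk (h ▸ hl)
      simp [mix, this, hφ l (List.mem_cons_of_mem _ hl)]
    have h2 := digitMap_of_notMem b (ks := ks) (mix top (Sum.inl k.succ) φ) (i := k.succ)
      fun l hl h => hk (Fin.succ_injective _ h ▸ hl)
    rw [digitMap, mix]
    simp only [if_true, scale, h1, h2, Sum.inr_ne_inl, if_false]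
    simp only [mix, if_true, Sum.inl_ne_inr, if_false, h0, List.map_cons, listValue]
    have := invSqrtTwo_mul_self
    split_ifs <;> push_cast
    -- The coefficient is the sum of the two averaged factors, `(1 - 2v') - 1` here and `(1 - 2v') +
    -- 1` in the other case, times `φ top`.
    · linear_combination (-2 * (listValue (ks.map b) : ℂ)) * φ top * this
    · linear_combination (2 - 2 * (listValue (ks.map b) : ℂ)) * φ top * this

/-- The excitation amplitudes before the last gate on the ancilla, for the data `b`. -/
noncomputable def finalMap (b : Fin m → Bool) : Site (m + 1) → ℂ :=
  mix top (Sum.inl 0) (scale top (-1) (digitMap b (List.finRange m)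
    (mix top (Sum.inl 0) (Pi.single top 1))))

/-- The last averaging: `(1 - (1 - 2v))/2 = v`. Work qubit `0` belongs to no digit, so it keeps the
reference factor `1`. -/
lemma finalMap_top (b : Fin m → Bool) : finalMap b top = value b := by
  have h1 := digitMap_top b (List.nodup_finRange m) (mix top (Sum.inl 0) (Pi.single top 1))
    fun k _ => by simp [mix, Fin.succ_ne_zero]
  have h2 := digitMap_of_notMem b (ks := List.finRange m) (mix top (Sum.inl 0) (Pi.single top 1))
    (i := 0) fun k _ => Fin.succ_ne_zero k
  rw [← List.ofFn_eq_map, listValue_ofFn] at h1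
  rw [finalMap, mix]
  simp only [if_true, scale, h1, h2, Sum.inl_ne_inr, if_false]
  simp only [mix, if_true, Sum.inl_ne_inr, if_false, Pi.single_eq_same, ne_eq, not_false_eq_true,
    Pi.single_eq_of_ne]
  linear_combination (2 * (value b : ℂ)) * invSqrtTwo_mul_self

/-! ### The algorithm, its gate count and the measurement. -/

/-- The conversion algorithm. -/
noncomputable def conversion (n m : ℕ) : Algorithm n m (m + 1) where
  before := notOp :: mixOp 0 :: (digitCircuit (List.finRange m) ++ [signOp, mixOp 0, notOp])
  after := [.callAdjoint]

lemma countP_digitCircuit (ks : List (Fin m)) :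
    (digitCircuit ks : List (Op n m (m + 1))).countP Op.isGate = 3 * ks.length ∧
      (digitCircuit ks : List (Op n m (m + 1))).countP Op.isCall = 0 := by
  induction ks with
  | nil => simp [digitCircuit]
  | cons k ks ih =>
    simp only [digitCircuit, List.countP_cons, List.countP_append, List.countP_nil, ih.1, ih.2,
      mixOp, controlledSignOp, Op.isGate, Op.isCall, List.length_cons]
    constructor
    · simp
      ring
    · simp

lemma gateCount_conversion : (conversion n m).gateCount = 3 * m + 5 := by
  simp [Algorithm.gateCount, conversion, List.countP_cons, List.countP_append,
    countP_digitCircuit, mixOp, notOp, signOp, Op.isGate]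

lemma callCount_conversion : (conversion n m).callCount = 1 := by
  simp [Algorithm.callCount, conversion, List.countP_cons, List.countP_append,
    countP_digitCircuit, mixOp, notOp, signOp, Op.isCall]

lemma projectAncilla_smul (c : ℂ) (ψ : State (Wire n m w)) :
    projectAncilla (c • ψ) = c • projectAncilla ψ := by
  funext x
  simp [projectAncilla]

lemma projectAncilla_sum {α : Type} (s : Finset α) (f : α → State (Wire n m w)) :
    projectAncilla (∑ a ∈ s, f a) = ∑ a ∈ s, projectAncilla (f a) := by
  funext x
  by_cases h : x ancilla = false <;> simp [projectAncilla, h]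

lemma projectAncilla_ket (x : Wire n m w → Bool) :
    projectAncilla (ket x) = if x ancilla = false then ket x else 0 := by
  funext z
  by_cases hz : z = x
  · subst hz
    by_cases h : z ancilla = false <;> simp [projectAncilla, h]
  · have : (ket x : State (Wire n m w)) z = 0 := Pi.single_eq_of_ne hz _
    by_cases h : x ancilla = false <;> simp [projectAncilla, h, this]

lemma run_notOp_label (U : unitaryGroup (Fin n ⊕ Fin m → Bool) ℂ) (j : Fin n → Bool)
    (b : Fin m → Bool) :
    notOp.run U (ket (label j b (fun _ : Fin w => false) false)) =
      excitation j b (Pi.single top 1) := by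
  have h : excitation j b (Pi.single top 1) = ket (excited j b (top : Site w)) := by
    rw [excitation, Finset.sum_eq_single top, Pi.single_eq_same, one_smul]
    · intro s _ hs
      rw [Pi.single_eq_of_ne hs, zero_smul]
    · simp
  rw [h]
  refine (notGate_ket _ _).trans (congrArg ket (funext fun i => ?_))
  rcases i with i | i | i | i <;> simp [label, excited, siteWire, Function.update]

/-- After the flip, the ancilla reads `0` exactly when the excitation sat there, and then every work
qubit is empty. -/
lemma projectAncilla_run_notOp (U : unitaryGroup (Fin n ⊕ Fin m → Bool) ℂ) (j : Fin n → Bool)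
    (b : Fin m → Bool) (φ : Site w → ℂ) :
    projectAncilla (notOp.run U (excitation j b φ)) =
      φ top • ket (label j b (fun _ => false) false) := by
  have h : notOp.run U (excitation j b φ) = ∑ s, φ s • ket (Function.update (excited j b s)
      (siteWire top) (!excited j b s (siteWire top))) :=
    (applyOn_excitation _ _ j b φ).trans
      (Finset.sum_congr rfl fun s _ => congrArg (φ s • ·) (notGate_ket _ _))
  have ha : (ancilla : Wire n m w) = siteWire top := rfl
  rw [h, projectAncilla_sum, Finset.sum_eq_single top]
  · rw [projectAncilla_smul, projectAncilla_ket, ha, Function.update_self, if_pos (by simp)]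
    refine congrArg (fun x => φ top • ket x) (funext fun i => ?_)
    rcases i with i | i | i | i <;> simp [label, excited, siteWire, Function.update]
  · intro s _ hs
    rw [projectAncilla_smul, projectAncilla_ket, ha, Function.update_self,
      if_neg (by simp [hs.symm]), smul_zero]
  · simp

lemma projectAncilla_runOps_conversion (U : unitaryGroup (Fin n ⊕ Fin m → Bool) ℂ)
    (d : (Fin n → Bool) → Fin m → Bool) :
    projectAncilla (runOps U (conversion n m).before (digitalState (m + 1) d)) =
      (Real.sqrt (2 ^ n : ℝ) : ℂ)⁻¹ • ∑ j, (value (d j) : ℂ) •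
        ket (label j (d j) (fun _ => false) false) := by
  rw [digitalState, runOps_smul, runOps_sum, projectAncilla_smul, projectAncilla_sum]
  refine congrArg _ (Finset.sum_congr rfl fun j _ => ?_)
  rw [← finalMap_top, ← projectAncilla_run_notOp U, conversion, runOps_cons, run_notOp_label,
    runOps_cons, run_mixOp, runOps_append, runOps_digitCircuit, runOps_cons, signOp, Op.run,
    signGate_excitation, runOps_cons, run_mixOp]
  rfl

lemma weight_smul (c : ℂ) (ψ : State (Wire n m w)) : weight (c • ψ) = ‖c‖ ^ 2 * weight ψ := by
  simp [weight, mul_pow, Finset.mul_sum]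

/-- Pythagoras for distinct basis states. -/
lemma weight_sum_ket {α ι : Type} [Fintype α] [Fintype (ι → Bool)] [DecidableEq (ι → Bool)]
    (f : α → ℂ) {x : α → ι → Bool} (hx : Function.Injective x) :
    weight (∑ a, f a • ket (x a)) = ∑ a, ‖f a‖ ^ 2 := by
  classical
  have h (z : ι → Bool) : (∑ a, f a • ket (x a)) z = ∑ a, if z = x a then f a else 0 := by
    simp [ket, Pi.single_apply]
  simp only [weight, h]
  rw [← Finset.sum_subset (Finset.subset_univ (Finset.univ.image x)),
    Finset.sum_image hx.injOn]
  · simp [hx.eq_iff]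
  · intro z _ hz
    have : ∀ a, z ≠ x a := fun a ha =>
      hz (Finset.mem_image.2 ⟨a, Finset.mem_univ _, ha.symm⟩)
    simp [this]

lemma successProb_conversion (U : unitaryGroup (Fin n ⊕ Fin m → Bool) ℂ)
    (d : (Fin n → Bool) → Fin m → Bool) :
    (conversion n m).successProb U (digitalState (m + 1) d) =
      (∑ j, value (d j) ^ 2) / 2 ^ n := by
  have hx : Function.Injective
      fun j => (label j (d j) (fun _ => false) false : Wire n m (m + 1) → Bool) :=
    fun i j h => funext fun k => congrFun h (Sum.inl k)
  rw [Algorithm.successProb, projectAncilla_runOps_conversion, weight_smul, weight_sum_ket _ hx,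
    norm_inv, Complex.norm_real, Real.norm_of_nonneg (Real.sqrt_nonneg _), inv_pow,
    Real.sq_sqrt (by positivity), inv_mul_eq_div]
  simp

/-! ### Erasing the data register. -/

lemma run_callAdjoint_label {U : unitaryGroup (Fin n ⊕ Fin m → Bool) ℂ}
    {d : (Fin n → Bool) → Fin m → Bool} (hU : IsDigitalEncoding d U) (j : Fin n → Bool)
    (y : Fin w → Bool) (a : Bool) :
    Op.callAdjoint.run U (ket (label j (d j) y a)) = ket (label j (fun _ => false) y a) := by
  -- Unitarity inverts the encoding equation, which determines exactly the column of `U_D†` needed.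
  have hcol : U.1.conjTranspose *ᵥ ket (Sum.elim j (d j)) = ket (Sum.elim j fun _ => false) := by
    rw [← hU j, mulVec_mulVec, ← star_eq_conjTranspose, mem_unitaryGroup_iff'.1 U.2, one_mulVec]
  have hentry (z) : U.1.conjTranspose z (Sum.elim j (d j)) =
      (Pi.single (Sum.elim j fun _ => false) 1 : (Fin n ⊕ Fin m → Bool) → ℂ) z := by
    have := congrFun hcol z
    rwa [ket, mulVec_single_one] at this
  have hx : (fun k => label j (d j) y a (addressData n m w k)) = Sum.elim j (d j) := by
    funext k
    rcases k with k | k <;> rfl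
  refine (applyOn_ket _ _ _).trans ?_
  rw [hx, Finset.sum_eq_single (Sum.elim j fun _ => false), hentry, Pi.single_eq_same, one_smul]
  · refine congrArg ket (funext fun i => ?_)
    rcases i with i | i | i
    · exact (addressData n m w).injective.extend_apply _ _ (Sum.inl i)
    · exact (addressData n m w).injective.extend_apply _ _ (Sum.inr i)
    · rw [Function.extend_apply']
      · rfl
      · rintro ⟨k | k, hk⟩
        · exact Sum.inl_ne_inr hk
        · exact Sum.inl_ne_inr (Sum.inr_injective hk)
  · intro z _ hz
    rw [hentry, Pi.single_eq_of_ne hz, zero_smul]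
  · simp

lemma output_conversion {U : unitaryGroup (Fin n ⊕ Fin m → Bool) ℂ}
    {d : (Fin n → Bool) → Fin m → Bool} (hU : IsDigitalEncoding d U) :
    (conversion n m).output U (digitalState (m + 1) d) = analogState (m + 1) d := by
  rw [Algorithm.output, successProb_conversion, projectAncilla_runOps_conversion, runOps_smul,
    runOps_smul, runOps_sum, smul_smul, analogState]
  congr 1
  -- The factors `√(2^n)` cancel. With `0⁻¹ = 0` the identity of scalars persists when all data
  -- vanish.
  · rw [Real.sqrt_div' _ (by positivity), Complex.ofReal_div, inv_div, div_mul_eq_mul_div,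
      mul_inv_cancel₀, one_div]
    exact Complex.ofReal_ne_zero.2 (Real.sqrt_pos.2 (by positivity)).ne'
  · refine Finset.sum_congr rfl fun j _ => ?_
    rw [runOps_smul]
    exact congrArg _ (run_callAdjoint_label hU j _ _)

end Circuit

end QDAC

theorem theorem1 :
    ∃ p : Polynomial ℝ, ∀ n m : ℕ, ∃ (w : ℕ) (A : QDAC.Algorithm n m w),
      (∀ ε : ℝ, ε = 2⁻¹ ^ m → (A.gateCount : ℝ) ≤ p.eval (Real.log (1 / ε))) ∧
      A.callCount = 1 ∧
      ∀ (d : (Fin n → Bool) → Fin m → Bool)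
        (U : Matrix.unitaryGroup (Fin n ⊕ Fin m → Bool) ℂ),
        QDAC.IsDigitalEncoding d U →
          A.successProb U (QDAC.digitalState w d)
              = (∑ j : Fin n → Bool, QDAC.value (d j) ^ 2) / 2 ^ n ∧
          ((∃ j : Fin n → Bool, QDAC.value (d j) ≠ 0) →
            A.output U (QDAC.digitalState w d) = QDAC.analogState w d) := by
  -- Since `log (1/ε) = m log 2`, this polynomial takes the value `3m + 5`, the exact gate count.
  refine ⟨Polynomial.C (3 / Real.log 2) * Polynomial.X + Polynomial.C 5, fun n m =>
    ⟨m + 1, QDAC.conversion n m, ?_, QDAC.callCount_conversion, fun d U hU =>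
      ⟨QDAC.successProb_conversion U d, fun _ => QDAC.output_conversion hU⟩⟩⟩
  rintro ε rfl
  have hlog : Real.log 2 ≠ 0 := (Real.log_pos one_lt_two).ne'
  simp only [QDAC.gateCount_conversion, Polynomial.eval_add, Polynomial.eval_mul,
    Polynomial.eval_C, Polynomial.eval_X, one_div, inv_pow, inv_inv, Real.log_pow]
  push_cast
  refine le_of_eq ?_
  field_simp
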